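/- All rings are commutative with identity. A ring is called coherent if each of its finitely generated ideals is finitely presented, and (without any Noetherian assumption) regular if each of its finitely generated ideals has finite projective dimension. A normalized value map on a ring $A$ is a map $v : A \to \mathbb{R} \cup \{\infty\}$ such that, for all $a, b \in A$: $v(ab) = v(a) + v(b)$; $v(a+b) \ge \min\{v(a), v(b)\}$; $v(a) = \infty$ if and only if $a = 0$; $v(a) \ge 0$; and $v(a) > 0$ whenever $a$ is not a unit. If $A$ has prime characteristic $p$ and $I$ is an ideal of $A$, let $A^0$ be the set of elements of $A$ that lie in no minimal prime of $A$ and, for $q = p^e$, let $I^{[q]}$ be the ideal generated by the $q$-th powers of all elements of $I$. The tight closure $I^*$ is the set of all $x \in A$ for which there is $c \in A^0$ such that $c x^q \in I^{[q]}$ for all sufficiently large powers $q = p^e$ of $p$; the ideal $I$ is tightly closed if $I^* = I$. Lemma. Let $A$ be a coherent regular ring of prime characteristic $p$. Then: (i) the Frobenius map $F : A \to A$, $a \mapsto a^p$, is flat; (ii) if $A$ is equipped with a normalized value map, then every finitely generated ideal of $A$ is tightly closed. -/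

import Mathlib

/-- A commutative ring is coherent if each of its finitely generated ideals is finitely
presented (as a module). -/
def IsCoherentRing (A : Type*) [CommRing A] : Prop :=
  ∀ I : Ideal A, I.FG → Module.FinitePresentation A I

/-- A (not necessarily Noetherian) commutative ring is regular if each of its finitely generated
ideals has finite projective dimension (as a module). -/
def IsNonNoetherianRegularRing (A : Type*) [CommRing A] : Prop :=
  ∀ I : Ideal A, I.FG → ∃ n : ℕ, CategoryTheory.HasProjectiveDimensionLE (ModuleCat.of A I) n

/-- A value map on `A` is a map `v : A → ℝ ∪ {∞}` with `v (a b) = v a + v b`,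
`v (a + b) ≥ min (v a) (v b)`, and `v a = ∞` exactly when `a = 0`. -/
structure IsValueMap {A : Type*} [CommRing A] (v : A → WithTop ℝ) : Prop where
  map_mul : ∀ a b : A, v (a * b) = v a + v b
  map_add : ∀ a b : A, min (v a) (v b) ≤ v (a + b)
  eq_top_iff : ∀ a : A, v a = ⊤ ↔ a = 0

/-- A value map is normalized if it is nonnegative on `A` and positive on the non-units. -/
structure IsNormalizedValueMap {A : Type*} [CommRing A] (v : A → WithTop ℝ) : Prop
    extends IsValueMap v where
  nonneg : ∀ a : A, 0 ≤ v a
  pos_of_not_isUnit : ∀ a : A, ¬ IsUnit a → 0 < v a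

/-- The ideal `I^[q]` generated by the `q`-th powers of all elements of `I`. -/
def bracketPower {A : Type*} [CommRing A] (I : Ideal A) (q : ℕ) : Ideal A :=
  Ideal.span {y : A | ∃ a ∈ I, y = a ^ q}

/-- The set `A⁰` of the elements of `A` that lie in no minimal prime of `A`. -/
def minimalPrimesCompl (A : Type*) [CommRing A] : Set A :=
  {c : A | ∀ P ∈ minimalPrimes A, c ∉ P}

/-- The tight closure `I*` of an ideal `I` of a ring `A` of prime characteristic `p`:
all `x` for which some `c ∈ A⁰` satisfies `c x^q ∈ I^[q]` for all large `q = p^e`. -/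
def tightClosure {A : Type*} [CommRing A] (p : ℕ) (I : Ideal A) : Set A :=
  {x : A | ∃ c ∈ minimalPrimesCompl A, ∃ N : ℕ, ∀ e : ℕ, N ≤ e →
    c * x ^ p ^ e ∈ bracketPower I (p ^ e)}

/-- `I` is tightly closed if `I* = I`. -/
def IsTightlyClosed {A : Type*} [CommRing A] (p : ℕ) (I : Ideal A) : Prop :=
  tightClosure p I = (I : Set A)

open CategoryTheory Abelian

universe u

/-! ### Ext groups of modules. -/

section Ext

variable {R : Type u} [CommRing R]

/-! By the equational criterion, Frobenius is flat as soon as the syzygies of `a₁ᵖ, …, a_cᵖ` are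
generated by the `p`-th powers of the syzygies of `a₁, …, a_c`. Coherence and regularity give
`A/(a₁, …, a_c)` a finite resolution by finite free modules, the last one only projective, so it
suffices that the power map `φ` keeps such resolutions exact (`Matrix.CokerPdLE.kerSpannedBy`). This
is proved by induction on the length. A syzygy `w` violating the claim is studied at a prime minimal
over its annihilator modulo the expected syzygies; there it becomes torsion for the maximal ideal.
Over a local ring the projective dimension is at most the depth
(`Matrix.CokerPdLE.exists_le_depthGE`), so the module in which `w` lives has positive depth and no
such torsion. Without Noetherian hypotheses, depth is measured by vanishing of Ext from torsion
modules rather than by regular sequences. For tight closure, suppose `x ∉ I`. Then `x` has only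
non-unit coefficients in the syzygies of `x` and generators of `I`, so their values are at least
some `ε > 0`. If `c x^q ∈ I^[q]`, then `c` is a combination of `q`-th powers of finitely many such
coefficients, whence `v c ≥ q ε`. Letting `q` grow forces `c = 0`. -/

lemma ext_eq_zero_of_forall_component {n : ℕ} (N : ModuleCat.{u} R) {j : ℕ}
    (e : Ext N (ModuleCat.of R (Fin n → R)) j)
    (h : ∀ i, e.comp (Ext.mk₀ (ModuleCat.ofHom (LinearMap.proj i : (Fin n → R) →ₗ[R] R)))
      (add_zero j) = 0) : e = 0 := by
  have h2 : 𝟙 (ModuleCat.of R (Fin n → R)) = ∑ i : Fin n,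
      ModuleCat.ofHom (LinearMap.proj i : (Fin n → R) →ₗ[R] R) ≫
        ModuleCat.ofHom (LinearMap.single R (fun _ : Fin n => R) i) := by
    rw [ModuleCat.hom_ext_iff, ModuleCat.hom_sum, ModuleCat.hom_id]
    refine LinearMap.ext fun x => ?_
    simp only [LinearMap.sum_apply, LinearMap.id_apply, ModuleCat.hom_comp, ModuleCat.hom_ofHom,
      LinearMap.comp_apply, LinearMap.proj_apply, LinearMap.single_apply]
    exact (Finset.univ_sum_single x).symm
  rw [← Ext.comp_mk₀_id e, h2, Ext.mk₀_sum, Ext.comp_sum]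
  refine Finset.sum_eq_zero fun i _ => ?_
  rw [← Ext.mk₀_comp_mk₀, ← Ext.comp_assoc_of_second_deg_zero, h, Ext.zero_comp]

/-- A short exact sequence of linear maps, as a short complex in the category of modules. -/
lemma shortExact_moduleCat {M₁ M₂ M₃ : Type u} [AddCommGroup M₁] [Module R M₁]
    [AddCommGroup M₂] [Module R M₂] [AddCommGroup M₃] [Module R M₃]
    (f : M₁ →ₗ[R] M₂) (g : M₂ →ₗ[R] M₃) (hf : Function.Injective f)
    (hfg : Function.Exact f g) (hg : Function.Surjective g) :
    (ShortComplex.mk (ModuleCat.ofHom f) (ModuleCat.ofHom g) (by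
      rw [← ModuleCat.ofHom_comp, hfg.linearMap_comp_eq_zero]; rfl)).ShortExact where
  exact := by
    rw [ShortComplex.ShortExact.moduleCat_exact_iff_function_exact]
    exact hfg
  mono_f := (ModuleCat.mono_iff_injective _).mpr hf
  epi_g := (ModuleCat.epi_iff_surjective _).mpr hg

/-- Finitely many commuting locally nilpotent operators have a common kernel vector. -/
lemma exists_ne_zero_forall_smul_eq_zero {E : Type*} [AddCommGroup E] [Module R E] {n : ℕ}
    (a : Fin n → R) (h : ∀ i, ∃ s : ℕ, ∀ e : E, a i ^ s • e = 0) (x : E) (hx : x ≠ 0) :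
    ∃ y : E, y ≠ 0 ∧ ∀ i, a i • y = 0 := by
  induction n with
  | zero => exact ⟨x, hx, fun i => i.elim0⟩
  | succ n ih =>
    obtain ⟨y, hy, hy'⟩ := ih (fun i => a i.succ) (fun i => h i.succ)
    classical
    obtain ⟨s, hs⟩ := h 0
    have hex : ∃ s : ℕ, a 0 ^ s • y = 0 := ⟨s, hs y⟩
    have hpos : Nat.find hex ≠ 0 := fun h0 => hy (by simpa [h0] using Nat.find_spec hex)
    obtain ⟨t, ht⟩ := Nat.exists_eq_succ_of_ne_zero hpos
    -- The last nonzero multiple of `y` by a power of `a 0`.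
    refine ⟨a 0 ^ t • y, Nat.find_min hex (by omega), fun i => ?_⟩
    refine Fin.cases ?_ (fun i => ?_) i
    · have hz := Nat.find_spec hex
      rw [ht] at hz
      rwa [smul_smul, ← pow_succ']
    · rw [smul_comm, hy', smul_zero]

end Ext

/-! ### Depth over a local ring. -/

section Depth

variable {R : Type u} [CommRing R] [IsLocalRing R]

/-- Every element of the maximal ideal acts nilpotently on `N`. -/
def IsMaxTorsion (R : Type u) [CommRing R] [IsLocalRing R] (N : Type u) [AddCommGroup N]
    [Module R N] : Prop :=
  ∀ a ∈ IsLocalRing.maximalIdeal R, ∃ s : ℕ, ∀ x : N, a ^ s • x = 0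

/-- The depth of `M` at the maximal ideal is at least `k`: the groups `Ext^j(N, M)` vanish for
`j < k` and all modules `N` on which the maximal ideal acts nilpotently. -/
def DepthGE (R : Type u) [CommRing R] [IsLocalRing R] (k : ℕ) (M : Type u) [AddCommGroup M]
    [Module R M] : Prop :=
  ∀ N : ModuleCat.{u} R, IsMaxTorsion R N → ∀ j < k,
    ∀ e : Ext N (ModuleCat.of R M) j, e = 0

variable {M M₁ M₂ M₃ : Type u} [AddCommGroup M] [Module R M] [AddCommGroup M₁] [Module R M₁]
  [AddCommGroup M₂] [Module R M₂] [AddCommGroup M₃] [Module R M₃]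

lemma DepthGE.zero : DepthGE R 0 M := fun _ _ _ hj => absurd hj (Nat.not_lt_zero _)

lemma DepthGE.mono {k l : ℕ} (h : DepthGE R k M) (hl : l ≤ k) : DepthGE R l M :=
  fun N hN j hj => h N hN j (hj.trans_le hl)

lemma DepthGE.of_leftInverse {k : ℕ} (h : DepthGE R k M₂) (f : M₁ →ₗ[R] M₂) (g : M₂ →ₗ[R] M₁)
    (hgf : g ∘ₗ f = LinearMap.id) : DepthGE R k M₁ := by
  intro N hN j hj e
  have h1 : e.comp (Ext.mk₀ (ModuleCat.ofHom f)) (add_zero j) = 0 := h N hN j hj _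
  have h2 : ModuleCat.ofHom f ≫ ModuleCat.ofHom g = 𝟙 (ModuleCat.of R M₁) := by
    rw [← ModuleCat.ofHom_comp, hgf, ModuleCat.ofHom_id]
  rw [← Ext.comp_mk₀_id e, ← h2, ← Ext.mk₀_comp_mk₀, ← Ext.comp_assoc_of_second_deg_zero, h1,
    Ext.zero_comp]

lemma DepthGE.pi {k : ℕ} (h : DepthGE R k R) (n : ℕ) : DepthGE R k (Fin n → R) :=
  fun N hN j hj e => ext_eq_zero_of_forall_component N e fun _ => h N hN j hj _

/-- The kernel comes from `Ext^(j-1)(N, M₃)`, so the borderline degree `j = k` is included. -/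
lemma ext_injective_of_depthGE {k j : ℕ} (f : M₁ →ₗ[R] M₂) (g : M₂ →ₗ[R] M₃)
    (hf : Function.Injective f) (hfg : Function.Exact f g) (hg : Function.Surjective g)
    (h : DepthGE R k M₃) (hj : j ≤ k) {N : ModuleCat.{u} R} (hN : IsMaxTorsion R N)
    (e : Ext N (ModuleCat.of R M₁) j)
    (he : e.comp (Ext.mk₀ (ModuleCat.ofHom f)) (add_zero j) = 0) : e = 0 := by
  have hS := shortExact_moduleCat f g hf hfg hg
  rcases j with _ | j
  · have := hS.mono_f
    exact Ext.postcomp_mk₀_injective_of_mono N (ModuleCat.ofHom f) (by simpa using he)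
  · obtain ⟨x, rfl⟩ := Ext.covariant_sequence_exact₁ N hS e he rfl
    rw [h N hN j hj x, Ext.zero_comp]

/-- Depth of the submodule in a short exact sequence. -/
lemma DepthGE.left {k l : ℕ} (f : M₁ →ₗ[R] M₂) (g : M₂ →ₗ[R] M₃)
    (hf : Function.Injective f) (hfg : Function.Exact f g) (hg : Function.Surjective g)
    (h3 : DepthGE R k M₃) (h2 : DepthGE R l M₂) (hl : l ≤ k + 1) : DepthGE R l M₁ :=
  fun N hN j hj e => ext_injective_of_depthGE f g hf hfg hg h3 (by omega) hN e (h2 N hN j hj _)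

/-- Depth of the quotient in a short exact sequence. -/
lemma DepthGE.right {k : ℕ} (f : M₁ →ₗ[R] M₂) (g : M₂ →ₗ[R] M₃)
    (hf : Function.Injective f) (hfg : Function.Exact f g) (hg : Function.Surjective g)
    (h1 : DepthGE R (k + 1) M₁) (h2 : DepthGE R k M₂) : DepthGE R k M₃ := by
  intro N hN j hj e
  have hS := shortExact_moduleCat f g hf hfg hg
  obtain ⟨x, rfl⟩ := Ext.covariant_sequence_exact₃ N hS e rfl (h1 N hN (j + 1) (by omega) _)
  rw [h2 N hN j hj x, Ext.zero_comp]

/-- A module of positive depth has no element on which the maximal ideal acts nilpotently. -/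
lemma DepthGE.eq_zero_of_torsion (h : DepthGE R 1 M) (x : M)
    (hx : ∀ a ∈ IsLocalRing.maximalIdeal R, ∃ s : ℕ, a ^ s • x = 0) : x = 0 := by
  let S : Submodule R M := Submodule.span R {x}
  have hS : IsMaxTorsion R (ModuleCat.of R S) := by
    intro a ha
    obtain ⟨s, hs⟩ := hx a ha
    refine ⟨s, fun y => ?_⟩
    obtain ⟨y, hy⟩ := y
    obtain ⟨b, rfl⟩ := Submodule.mem_span_singleton.mp hy
    apply Subtype.ext
    change a ^ s • b • x = 0
    rw [smul_comm, hs, smul_zero]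
  have h0 := h _ hS 0 one_pos (Ext.mk₀ (ModuleCat.ofHom S.subtype))
  rw [Ext.mk₀_eq_zero_iff] at h0
  have := congrArg (fun f => f.hom ⟨x, Submodule.mem_span_singleton_self x⟩) h0
  simpa using this

/-- The exponent in `IsMaxTorsion` is uniform on `N`, so `a ^ s` kills the identity of `N` and hence
every Ext group out of `N`. -/
lemma exists_pow_smul_ext_eq_zero {N : ModuleCat.{u} R} (hN : IsMaxTorsion R N) {j : ℕ}
    {Y : ModuleCat.{u} R} {a : R} (ha : a ∈ IsLocalRing.maximalIdeal R) :
    ∃ s : ℕ, ∀ e : Ext N Y j, a ^ s • e = 0 := by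
  obtain ⟨s, hs⟩ := hN a ha
  refine ⟨s, fun e => ?_⟩
  have h0 : a ^ s • 𝟙 N = 0 := by
    ext x
    exact hs x
  calc a ^ s • e = a ^ s • (Ext.mk₀ (𝟙 N)).comp e (zero_add j) := by rw [Ext.mk₀_id_comp]
    _ = (Ext.mk₀ (a ^ s • 𝟙 N)).comp e (zero_add j) := by rw [Ext.mk₀_smul, Ext.smul_comp]
    _ = 0 := by rw [h0, Ext.mk₀_zero, Ext.zero_comp]

/-- If `R → M → Rʳ` is such that the first map is a split injection, the second is injective with
cokernel of depth at least `k`, and the composition has entries in the maximal ideal, then the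
depth of `R` is at least `k + 1`. -/
lemma DepthGE.succ_of_minimal {k r : ℕ} (s : R →ₗ[R] M) (μ : M →ₗ[R] R)
    (hs : μ ∘ₗ s = LinearMap.id) (f : M →ₗ[R] (Fin r → R)) (g : (Fin r → R) →ₗ[R] M₃)
    (hf : Function.Injective f) (hfg : Function.Exact f g) (hg : Function.Surjective g)
    (h3 : DepthGE R k M₃) (hmax : ∀ i, f (s 1) i ∈ IsLocalRing.maximalIdeal R) :
    DepthGE R (k + 1) R := by
  intro N hN j hj x
  by_contra hx
  obtain ⟨y, hy, hy'⟩ := exists_ne_zero_forall_smul_eq_zero (f (s 1))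
    (fun i => exists_pow_smul_ext_eq_zero hN (hmax i)) x hx
  apply hy
  -- In `Ext^j(N, Rʳ)` the components of the image of `y` are its multiples by the entries of `f (s
  -- 1)`, which vanish by the choice of `y`.
  have hz : y.comp (Ext.mk₀ (ModuleCat.ofHom s)) (add_zero j) = 0 := by
    refine ext_injective_of_depthGE f g hf hfg hg h3 (by omega) hN _ ?_
    apply ext_eq_zero_of_forall_component
    intro i
    rw [Ext.comp_assoc_of_second_deg_zero, Ext.comp_assoc_of_second_deg_zero, Ext.mk₀_comp_mk₀,
      Ext.mk₀_comp_mk₀, ← hy' i, Ext.smul_eq_comp_mk₀]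
    congr 2
    ext
    simp
  have h2 : ModuleCat.ofHom s ≫ ModuleCat.ofHom μ = 𝟙 (ModuleCat.of R R) := by
    rw [← ModuleCat.ofHom_comp, hs, ModuleCat.ofHom_id]
  rw [← Ext.comp_mk₀_id y, ← h2, ← Ext.mk₀_comp_mk₀, ← Ext.comp_assoc_of_second_deg_zero, hz,
    Ext.zero_comp]

end Depth

/-! ### Resolutions given by matrices. -/

namespace Matrix

section Basic

variable {R S : Type*} [CommRing R] [CommRing S] {r c d : ℕ}

/-- The cokernel of the linear map given by a matrix. -/
abbrev Coker (C : Matrix (Fin r) (Fin c) R) : Type _ :=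
  (Fin r → R) ⧸ LinearMap.range C.mulVecLin

/-- The matrix `C` is von Neumann regular: `C G C = C` for some matrix `G`. Equivalently, its
cokernel is projective. -/
def HasPseudoinverse (C : Matrix (Fin r) (Fin c) R) : Prop :=
  ∃ G : Matrix (Fin c) (Fin r) R, C * G * C = C

/-- The cokernel of `C` has a resolution of length at most `n` by finite free modules, except that
the last one is only projective, starting with `C`. -/
def CokerPdLE : ℕ → ∀ {r c : ℕ}, Matrix (Fin r) (Fin c) R → Prop
  | 0, _, _, C => HasPseudoinverse C
  | n + 1, _, c, C => ∃ (d : ℕ) (D : Matrix (Fin c) (Fin d) R),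
      Function.Exact D.mulVec C.mulVec ∧ CokerPdLE n D

/-- The kernel of `φ(C)` is generated by the image under `φ` of the kernel of `C`. -/
def KerSpannedBy (φ : R →+* R) (C : Matrix (Fin r) (Fin c) R) : Prop :=
  ∀ w, C.map φ *ᵥ w = 0 → w ∈ Submodule.span R ((fun z => φ ∘ z) '' {z | C *ᵥ z = 0})

lemma map_mulVec_comp (f : R →+* S) (C : Matrix (Fin r) (Fin c) R) (v : Fin c → R) :
    C.map f *ᵥ (f ∘ v) = f ∘ (C *ᵥ v) :=
  funext fun i => (f.map_mulVec C v i).symm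

lemma mul_eq_zero_of_exact {C : Matrix (Fin r) (Fin c) R} {D : Matrix (Fin c) (Fin d) R}
    (h : Function.Exact D.mulVec C.mulVec) : C * D = 0 := by
  refine Matrix.toLin'.injective (LinearMap.ext fun x => ?_)
  simpa using (h (D *ᵥ x)).mpr ⟨x, rfl⟩

lemma span_image_ker_eq_range (φ : R →+* R) {C : Matrix (Fin r) (Fin c) R}
    {D : Matrix (Fin c) (Fin d) R} (h : Function.Exact D.mulVec C.mulVec) :
    Submodule.span R ((fun z => φ ∘ z) '' {z | C *ᵥ z = 0}) =
      LinearMap.range (D.map φ).mulVecLin := by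
  apply le_antisymm
  · rw [Submodule.span_le]
    rintro _ ⟨z, hz, rfl⟩
    obtain ⟨y, rfl⟩ := (h z).mp hz
    exact ⟨φ ∘ y, map_mulVec_comp φ D y⟩
  · rw [Matrix.range_mulVecLin, Submodule.span_le]
    rintro _ ⟨j, rfl⟩
    refine Submodule.subset_span ⟨D.col j, ?_, rfl⟩
    rw [Set.mem_ofPred_eq, ← Matrix.mulVec_single_one]
    exact (h _).mpr ⟨_, rfl⟩

lemma KerSpannedBy.exact {φ : R →+* R} {C : Matrix (Fin r) (Fin c) R}
    {D : Matrix (Fin c) (Fin d) R} (hC : KerSpannedBy φ C)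
    (h : Function.Exact D.mulVec C.mulVec) :
    Function.Exact (D.map φ).mulVec (C.map φ).mulVec := by
  intro w
  constructor
  · intro hw
    have := hC w hw
    rwa [span_image_ker_eq_range φ h] at this
  · rintro ⟨y, rfl⟩
    rw [Matrix.mulVec_mulVec, ← Matrix.map_mul, mul_eq_zero_of_exact h]
    simp

/-- The kernel is the image of `1 - G * C`, and the identity `C * G * C = C` survives any ring
homomorphism. -/
lemma HasPseudoinverse.kerSpannedBy (φ : R →+* R) {C : Matrix (Fin r) (Fin c) R}
    (h : HasPseudoinverse C) : KerSpannedBy φ C := by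
  obtain ⟨G, hG⟩ := h
  have hex : Function.Exact (1 - G * C).mulVec C.mulVec := by
    intro z
    constructor
    · intro hz
      exact ⟨z, by simp [Matrix.sub_mulVec, ← Matrix.mulVec_mulVec, hz]⟩
    · rintro ⟨y, rfl⟩
      rw [Matrix.mulVec_mulVec, Matrix.mul_sub, Matrix.mul_one, ← Matrix.mul_assoc, hG, sub_self,
        Matrix.zero_mulVec]
  intro w hw
  rw [span_image_ker_eq_range φ hex]
  refine ⟨w, ?_⟩
  have : (1 - G * C).map φ = 1 - G.map φ * C.map φ := by
    rw [← Matrix.map_mul, Matrix.map_sub φ (map_sub φ), Matrix.map_one φ (map_zero φ) (map_one φ)]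
  rw [Matrix.mulVecLin_apply, this, Matrix.sub_mulVec, ← Matrix.mulVec_mulVec, hw]
  simp

/-- The map induced on the cokernel by a matrix `C` with `C * D = 0`. -/
def cokerDesc (C : Matrix (Fin r) (Fin c) R) (D : Matrix (Fin c) (Fin d) R)
    (h : Function.Exact D.mulVec C.mulVec) : D.Coker →ₗ[R] (Fin r → R) :=
  (LinearMap.range D.mulVecLin).liftQ C.mulVecLin (by
    rintro _ ⟨y, rfl⟩
    exact (h _).mpr ⟨y, rfl⟩)

lemma cokerDesc_injective {C : Matrix (Fin r) (Fin c) R} {D : Matrix (Fin c) (Fin d) R}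
    (h : Function.Exact D.mulVec C.mulVec) : Function.Injective (cokerDesc C D h) := by
  rw [injective_iff_map_eq_zero]
  intro x hx
  obtain ⟨y, rfl⟩ := Submodule.Quotient.mk_surjective _ x
  rw [Submodule.Quotient.mk_eq_zero]
  exact (h y).mp hx

lemma cokerDesc_exact {C : Matrix (Fin r) (Fin c) R} {D : Matrix (Fin c) (Fin d) R}
    (h : Function.Exact D.mulVec C.mulVec) :
    Function.Exact (cokerDesc C D h) (LinearMap.range C.mulVecLin).mkQ := by
  intro x
  rw [Submodule.mkQ_apply, Submodule.Quotient.mk_eq_zero]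
  constructor
  · rintro ⟨y, rfl⟩
    exact ⟨Submodule.Quotient.mk y, rfl⟩
  · rintro ⟨y, rfl⟩
    obtain ⟨y, rfl⟩ := Submodule.Quotient.mk_surjective _ y
    exact ⟨y, rfl⟩

end Basic

/-! ### Projective dimension against depth over a local ring. -/

section Local

variable {R : Type u} [CommRing R] [IsLocalRing R] {r c d : ℕ}

/-- Over a local ring, if `im C` is projective, with `e` an idempotent of kernel `ker C`, then
either `coker C` is projective too, or some unimodular vector of the image of `e` is mapped by `C`
into the maximal ideal. -/
lemma hasPseudoinverse_or_exists_minimal (C : Matrix (Fin r) (Fin c) R)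
    (e : Matrix (Fin c) (Fin c) R)
    (he : e * e = e) (hCe : C * e = C) :
    HasPseudoinverse C ∨ ∃ u : Fin c → R, e *ᵥ u = u ∧ (∃ i, IsUnit (u i)) ∧
      ∀ i, (C *ᵥ u) i ∈ IsLocalRing.maximalIdeal R := by
  let π := IsLocalRing.residue R
  have hπ : Function.Surjective π := IsLocalRing.residue_surjective
  -- The dichotomy is whether `C` stays injective on the image of `e` over the residue field.
  by_cases h : ∀ u, e.map π *ᵥ u = u → C.map π *ᵥ u = 0 → u = 0
  · left
    let W := LinearMap.range (e.map π).mulVecLin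
    have hee : e.map π * e.map π = e.map π := by rw [← Matrix.map_mul, he]
    have hinj : LinearMap.ker ((C.map π).mulVecLin ∘ₗ W.subtype) = ⊥ := by
      rw [LinearMap.ker_eq_bot']
      rintro ⟨_, y, rfl⟩ hx
      apply Subtype.ext
      refine h _ ?_ hx
      simp only [Matrix.mulVecLin_apply, Matrix.mulVec_mulVec, hee]
    obtain ⟨g, hg⟩ := LinearMap.exists_leftInverse_of_injective _ hinj
    let Gb : Matrix (Fin c) (Fin r) (IsLocalRing.ResidueField R) :=
      LinearMap.toMatrix' (W.subtype ∘ₗ g)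
    have hGb : Gb * C.map π * e.map π = e.map π := by
      refine Matrix.toLin'.injective (LinearMap.ext fun x => ?_)
      have := congrArg Subtype.val (LinearMap.congr_fun hg ⟨e.map π *ᵥ x, x, rfl⟩)
      simp only [Matrix.toLin'_mul, LinearMap.comp_apply, Gb, Matrix.toLin'_toMatrix']
      exact this
    choose σ hσ using hπ
    let G : Matrix (Fin c) (Fin r) R := Gb.map σ
    have hG : G.map π = Gb := by
      ext i j
      exact hσ _
    -- `G` lifts a residual left inverse of `C` on the image of `e`. Thus `U` is the identity modulo
    -- the maximal ideal, hence invertible, and it corrects `G`.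
    let U := e * G * C * e + (1 - e)
    have hU : IsUnit U.det := by
      apply isUnit_of_map_unit π
      have : U.map π = 1 := by
        change ((e * G * C * e + (1 - e)) : Matrix _ _ R).map π = 1
        rw [Matrix.map_add π (map_add π), Matrix.map_sub π (map_sub π),
          Matrix.map_one π (map_zero π) (map_one π), Matrix.map_mul, Matrix.map_mul,
          Matrix.map_mul, hG, Matrix.mul_assoc (e.map π), Matrix.mul_assoc (e.map π), hGb, hee]
        abel
      rw [RingHom.map_det, RingHom.mapMatrix_apply, this, Matrix.det_one]
      exact isUnit_one
    have hUe : U * e = e * G * C := by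
      change (e * G * C * e + (1 - e)) * e = e * G * C
      rw [Matrix.add_mul, Matrix.sub_mul, Matrix.one_mul, he, sub_self, add_zero,
        Matrix.mul_assoc, he, Matrix.mul_assoc, hCe]
    refine ⟨U⁻¹ * e * G, ?_⟩
    calc C * (U⁻¹ * e * G) * C = C * (U⁻¹ * (e * G * C)) := by simp only [Matrix.mul_assoc]
      _ = C * (U⁻¹ * U * e) := by rw [← hUe, Matrix.mul_assoc]
      _ = C := by rw [Matrix.nonsing_inv_mul _ hU, Matrix.one_mul, hCe]
  · right
    push Not at h
    obtain ⟨u, hu, hCu, hu0⟩ := h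
    choose σ hσ using hπ
    have hσu : π ∘ (σ ∘ u) = u := funext fun i => hσ _
    have h1 : π ∘ (e *ᵥ (σ ∘ u)) = u := by
      rw [← map_mulVec_comp, hσu, hu]
    refine ⟨e *ᵥ (σ ∘ u), by rw [Matrix.mulVec_mulVec, he], ?_, fun i => ?_⟩
    · obtain ⟨i, hi⟩ := Function.ne_iff.mp hu0
      refine ⟨i, ?_⟩
      apply isUnit_of_map_unit π
      have := congrFun h1 i
      rw [Function.comp_apply] at this
      rw [this]
      exact isUnit_iff_ne_zero.mpr hi
    · rw [← IsLocalRing.residue_eq_zero_iff]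
      have := congrFun (map_mulVec_comp π C (e *ᵥ (σ ∘ u))) i
      rw [h1, hCu] at this
      exact this.symm

/-- Here `im C ≅ coker D` is projective. Unless it splits off, it has a free summand of rank one
mapped into the maximal ideal times `Rʳ`, and `DepthGE.succ_of_minimal` applies. -/
lemma cokerPdLE_zero_or_depthGE {k : ℕ} {C : Matrix (Fin r) (Fin c) R}
    {D : Matrix (Fin c) (Fin d) R} (h : Function.Exact D.mulVec C.mulVec)
    (hD : HasPseudoinverse D) (hk : DepthGE R k C.Coker) :
    HasPseudoinverse C ∨ DepthGE R (k + 1) R := by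
  obtain ⟨G, hG⟩ := hD
  have hCD := mul_eq_zero_of_exact h
  let e := 1 - D * G
  have heD : e * D = 0 := by
    change (1 - D * G) * D = 0
    rw [Matrix.sub_mul, Matrix.one_mul, hG, sub_self]
  have he : e * e = e := by
    change e * (1 - D * G) = e
    rw [Matrix.mul_sub, Matrix.mul_one, ← Matrix.mul_assoc, heD, Matrix.zero_mul, sub_zero]
  have hCe : C * e = C := by
    change C * (1 - D * G) = C
    rw [Matrix.mul_sub, Matrix.mul_one, ← Matrix.mul_assoc, hCD, Matrix.zero_mul, sub_zero]
  refine (hasPseudoinverse_or_exists_minimal C e he hCe).imp_right ?_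
  rintro ⟨u, hu, ⟨i, hi⟩, hmax⟩
  obtain ⟨a, ha⟩ := hi.exists_left_inv
  let s : R →ₗ[R] D.Coker :=
    (LinearMap.range D.mulVecLin).mkQ ∘ₗ LinearMap.toSpanSingleton R (Fin c → R) u
  let μ : D.Coker →ₗ[R] R := (LinearMap.range D.mulVecLin).liftQ
    (a • LinearMap.proj i ∘ₗ e.mulVecLin) (by
      rintro _ ⟨y, rfl⟩
      simp [heD])
  refine DepthGE.succ_of_minimal s μ ?_ (cokerDesc C D h) _ (cokerDesc_injective h)
    (cokerDesc_exact h) (Submodule.mkQ_surjective _) hk fun i => ?_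
  · refine LinearMap.ext_ring ?_
    change a * (e *ᵥ ((1 : R) • u)) i = 1
    rw [one_smul, hu, ha]
  · change (C *ᵥ ((1 : R) • u)) i ∈ _
    rw [one_smul]
    exact hmax i

/-- Each step along the resolution gains one unit of depth, up to `k`, so the last cokernel reaches
depth `k`; there either the resolution shortens or the ring gains depth. -/
lemma CokerPdLE.or_depthGE {n k : ℕ} {C : Matrix (Fin r) (Fin c) R} (hC : CokerPdLE (n + 1) C)
    (hR : DepthGE R k R) (hk : DepthGE R (k - n) C.Coker) :
    CokerPdLE n C ∨ DepthGE R (k + 1) R := by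
  induction n generalizing r c with
  | zero =>
    obtain ⟨d, D, h, hD⟩ := hC
    exact cokerPdLE_zero_or_depthGE h hD hk
  | succ n ih =>
    obtain ⟨d, D, h, hD⟩ := hC
    have hDk : DepthGE R (k - n) D.Coker :=
      DepthGE.left _ _ (cokerDesc_injective h) (cokerDesc_exact h) (Submodule.mkQ_surjective _)
        hk ((hR.pi r).mono (Nat.sub_le _ _)) (by omega)
    exact (ih hD hDk).imp_left fun h' => ⟨d, D, h, h'⟩

/-- Over a local ring, a matrix whose cokernel has finite projective dimension satisfies half of the
Auslander–Buchsbaum formula: the projective dimension is at most the depth of the ring. -/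
lemma CokerPdLE.exists_le_depthGE {n : ℕ} {C : Matrix (Fin r) (Fin c) R} (hC : CokerPdLE n C) :
    ∃ s ≤ n, CokerPdLE s C ∧ DepthGE R s R := by
  induction n with
  | zero => exact ⟨0, le_rfl, hC, DepthGE.zero⟩
  | succ n ih =>
    by_cases hn : CokerPdLE n C
    · obtain ⟨s, hs, h⟩ := ih hn
      exact ⟨s, hs.trans n.le_succ, h⟩
    · have key : ∀ k ≤ n + 1, DepthGE R k R := by
        intro k
        induction k with
        | zero => exact fun _ => DepthGE.zero
        | succ k ihk =>
          intro hk
          refine (hC.or_depthGE (ihk (by omega)) ?_).resolve_left hn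
          -- Since `k ≤ n`, the truncated difference is zero and nothing is required of the
          -- cokernel.
          rw [Nat.sub_eq_zero_of_le (by omega)]
          exact DepthGE.zero
      exact ⟨n + 1, le_rfl, hC, key _ le_rfl⟩

/-- Applying `φ` keeps the resolution exact by `hφ`, and each of its `n` steps costs one unit of
depth. -/
lemma CokerPdLE.depthGE_coker_map {n t : ℕ} {C : Matrix (Fin r) (Fin c) R} (hC : CokerPdLE n C)
    (φ : R →+* R) (hφ : ∀ m ≤ n, ∀ {r c : ℕ} (C : Matrix (Fin r) (Fin c) R), CokerPdLE m C →
      KerSpannedBy φ C) (hR : DepthGE R (n + t) R) : DepthGE R t (C.map φ).Coker := by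
  induction n generalizing r c t with
  | zero =>
    obtain ⟨G, hG⟩ := hC
    have hG' : C.map φ * G.map φ * C.map φ = C.map φ := by
      rw [← Matrix.map_mul, ← Matrix.map_mul, hG]
    rw [zero_add] at hR
    refine (hR.pi r).of_leftInverse ((LinearMap.range (C.map φ).mulVecLin).liftQ
      (1 - C.map φ * G.map φ).mulVecLin ?_) (LinearMap.range (C.map φ).mulVecLin).mkQ ?_
    · rintro _ ⟨y, rfl⟩
      rw [LinearMap.mem_ker, Matrix.mulVecLin_apply, Matrix.mulVecLin_apply, Matrix.mulVec_mulVec,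
        Matrix.sub_mul, Matrix.one_mul, hG', sub_self, Matrix.zero_mulVec]
    · refine Submodule.linearMap_qext _ (LinearMap.ext fun x => ?_)
      change (LinearMap.range (C.map φ).mulVecLin).mkQ ((1 - C.map φ * G.map φ) *ᵥ x) =
        (LinearMap.range (C.map φ).mulVecLin).mkQ x
      rw [← sub_eq_zero, ← map_sub, Submodule.mkQ_apply, Submodule.Quotient.mk_eq_zero]
      refine ⟨-(G.map φ *ᵥ x), ?_⟩
      simp [Matrix.sub_mulVec, Matrix.mulVec_neg]
  | succ n ih =>
    have hex := hφ _ le_rfl C hC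
    obtain ⟨d, D, h, hD⟩ := hC
    have hD' : DepthGE R (t + 1) (D.map φ).Coker :=
      ih hD (fun m hm => hφ m (by omega)) (hR.mono (by omega))
    have h' := hex.exact h
    exact DepthGE.right _ _ (cokerDesc_injective h') (cokerDesc_exact h')
      (Submodule.mkQ_surjective _) hD' ((hR.mono (by omega)).pi r)

/-- With length `s + 1` at most the depth of the ring, the next matrix `D` has length `s`, which
leaves depth at least one for `coker φ(D)`; the torsion class of `w` there must vanish. -/
lemma CokerPdLE.mem_span_of_torsion {n : ℕ} {C : Matrix (Fin r) (Fin c) R}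
    (hC : CokerPdLE (n + 1) C) (φ : R →+* R)
    (hφ : ∀ m ≤ n, ∀ {r c : ℕ} (C : Matrix (Fin r) (Fin c) R), CokerPdLE m C → KerSpannedBy φ C)
    {w : Fin c → R} (hw : C.map φ *ᵥ w = 0)
    (htors : ∀ a ∈ IsLocalRing.maximalIdeal R, ∃ s : ℕ,
      a ^ s • w ∈ Submodule.span R ((fun z => φ ∘ z) '' {z | C *ᵥ z = 0})) :
    w ∈ Submodule.span R ((fun z => φ ∘ z) '' {z | C *ᵥ z = 0}) := by
  obtain ⟨s, hs, hCs, hR⟩ := hC.exists_le_depthGE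
  rcases s with _ | s
  · exact hφ 0 (Nat.zero_le _) C hCs w hw
  · obtain ⟨d, D, h, hD⟩ := hCs
    have hdep : DepthGE R 1 (D.map φ).Coker :=
      hD.depthGE_coker_map φ (fun m hm => hφ m (by omega)) hR
    rw [span_image_ker_eq_range φ h] at htors ⊢
    rw [← Submodule.Quotient.mk_eq_zero]
    refine hdep.eq_zero_of_torsion _ fun a ha => ?_
    obtain ⟨s, hs⟩ := htors a ha
    exact ⟨s, by rwa [← Submodule.Quotient.mk_smul, Submodule.Quotient.mk_eq_zero]⟩

end Local

end Matrix

/-- If `Q` is minimal over `I`, then each element of `Q` is nilpotent modulo `I` locally at `Q`. -/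
lemma Ideal.exists_mul_pow_mem_of_mem_minimalPrimes {R : Type*} [CommRing R] {I Q : Ideal R}
    (hQ : Q ∈ I.minimalPrimes) {a : R} (ha : a ∈ Q) : ∃ u ∉ Q, ∃ n : ℕ, u * a ^ n ∈ I := by
  have := hQ.1.1
  by_contra! h
  obtain ⟨P, hP, hIP, hdisj⟩ := I.exists_le_prime_disjoint (Q.primeCompl ⊔ Submonoid.powers a) (by
    rw [Set.disjoint_left]
    intro x hx hx'
    obtain ⟨u, hu, _, ⟨n, rfl⟩, rfl⟩ := Submonoid.mem_sup.mp hx'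
    exact h u hu n hx)
  have hPQ : P ≤ Q := fun x hx => by
    by_contra hxQ
    exact Set.disjoint_left.mp hdisj hx ((le_sup_left : Q.primeCompl ≤ _) hxQ)
  exact Set.disjoint_left.mp hdisj (hQ.2 ⟨hP, hIP⟩ hPQ ha)
    ((le_sup_right : Submonoid.powers a ≤ _) (Submonoid.mem_powers a))

namespace Matrix

/-! ### Localization of resolutions. -/

section Localization

variable {R : Type*} [CommRing R] (M : Submonoid R) (S : Type*) [CommRing S] [Algebra R S]
  [IsLocalization M S] {r c d : ℕ}

include M in
lemma exists_smul_eq_algebraMap_comp (y : Fin c → S) :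
    ∃ (b : R) (_ : b ∈ M) (x : Fin c → R), algebraMap R S b • y = algebraMap R S ∘ x := by
  obtain ⟨⟨x, b⟩, hb⟩ := IsLocalizedModule.surj M
    (LinearMap.pi fun i : Fin c => Algebra.linearMap R S ∘ₗ LinearMap.proj i) y
  refine ⟨b, b.2, x, ?_⟩
  rw [algebraMap_smul]
  exact hb

include M in
lemma exists_smul_eq_zero_of_algebraMap_comp {x : Fin c → R} (hx : algebraMap R S ∘ x = 0) :
    ∃ b ∈ M, b • x = 0 := by
  obtain ⟨b, hb⟩ := (IsLocalizedModule.eq_zero_iff M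
    (LinearMap.pi fun i : Fin c => Algebra.linearMap R S ∘ₗ LinearMap.proj i)).mp hx
  exact ⟨b, b.2, hb⟩

variable {S} in
lemma algebraMap_comp_smul (b : R) (x : Fin c → R) :
    algebraMap R S ∘ (b • x) = algebraMap R S b • (algebraMap R S ∘ x) := by
  ext i
  simp

include M in
lemma exists_smul_mem_range_of_algebraMap_comp {E : Matrix (Fin c) (Fin d) R} {w : Fin c → R}
    (hw : algebraMap R S ∘ w ∈ LinearMap.range (E.map (algebraMap R S)).mulVecLin) :
    ∃ t ∈ M, t • w ∈ LinearMap.range E.mulVecLin := by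
  obtain ⟨y, hy⟩ := hw
  obtain ⟨b, hb, x, hx⟩ := exists_smul_eq_algebraMap_comp M S y
  have h0 : algebraMap R S ∘ (b • w - E *ᵥ x) = 0 := by
    have h1 : algebraMap R S ∘ (b • w) = algebraMap R S ∘ (E *ᵥ x) := by
      rw [algebraMap_comp_smul, ← hy, ← map_mulVec_comp, ← hx, Matrix.mulVec_smul]
      rfl
    ext i
    simpa [sub_eq_zero] using congrFun h1 i
  obtain ⟨t, ht, h⟩ := exists_smul_eq_zero_of_algebraMap_comp M S h0
  refine ⟨t * b, M.mul_mem ht hb, t • x, ?_⟩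
  rw [smul_sub, sub_eq_zero, smul_smul] at h
  rw [h, Matrix.mulVecLin_apply, Matrix.mulVec_smul]

include M in
lemma exact_map_of_isLocalization {C : Matrix (Fin r) (Fin c) R} {D : Matrix (Fin c) (Fin d) R}
    (h : Function.Exact D.mulVec C.mulVec) :
    Function.Exact (D.map (algebraMap R S)).mulVec (C.map (algebraMap R S)).mulVec := by
  intro y
  constructor
  · intro hy
    obtain ⟨b, hb, x, hx⟩ := exists_smul_eq_algebraMap_comp M S y
    have h0 : algebraMap R S ∘ (C *ᵥ x) = 0 := by
      rw [← map_mulVec_comp, ← hx, Matrix.mulVec_smul, hy, smul_zero]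
    obtain ⟨t, ht, h1⟩ := exists_smul_eq_zero_of_algebraMap_comp M S h0
    rw [← Matrix.mulVec_smul] at h1
    obtain ⟨z, hz⟩ := (h _).mp h1
    obtain ⟨s, hs⟩ := (IsLocalization.map_units S (⟨t * b, M.mul_mem ht hb⟩ : M)).exists_left_inv
    refine ⟨s • (algebraMap R S ∘ z), ?_⟩
    rw [Matrix.mulVec_smul, map_mulVec_comp, hz, algebraMap_comp_smul, ← hx, smul_smul, smul_smul,
      mul_assoc, ← map_mul, hs, one_smul]
  · rintro ⟨z, rfl⟩
    rw [Matrix.mulVec_mulVec, ← Matrix.map_mul, mul_eq_zero_of_exact h]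
    simp

include M in
lemma CokerPdLE.map_of_isLocalization {n : ℕ} {C : Matrix (Fin r) (Fin c) R}
    (h : CokerPdLE n C) : CokerPdLE n (C.map (algebraMap R S)) := by
  induction n generalizing r c with
  | zero =>
    obtain ⟨G, hG⟩ := h
    exact ⟨G.map (algebraMap R S), by rw [← Matrix.map_mul, ← Matrix.map_mul, hG]⟩
  | succ n ih =>
    obtain ⟨d, D, h, hD⟩ := h
    exact ⟨d, D.map _, exact_map_of_isLocalization M S h, ih hD⟩

end Localization

/-- If the cokernel of `C` has finite projective dimension and `φ` is an endomorphism of the form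
`a ↦ a ^ q`, then the kernel of `φ(C)` is generated by the image of the kernel of `C`. -/
theorem CokerPdLE.kerSpannedBy {q : ℕ} (n : ℕ) : ∀ {R : Type u} [CommRing R] (φ : R →+* R)
    (_ : ∀ a, φ a = a ^ q) (_ : 0 < q) {r c : ℕ} (C : Matrix (Fin r) (Fin c) R),
    CokerPdLE n C → KerSpannedBy φ C := by
  -- The ring varies in the induction, since the hypothesis is applied over a localization.
  induction n using Nat.strong_induction_on with
  | _ n ih =>
  intro R _ φ hφ hq r c C hC
  rcases n with _ | n
  · exact HasPseudoinverse.kerSpannedBy φ hC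
  intro w hw
  obtain ⟨d, D, h, hD⟩ := id hC
  by_contra hmem
  rw [span_image_ker_eq_range φ h] at hmem
  -- The annihilator of `w` modulo the expected syzygies.
  let I : Ideal R := (LinearMap.range (D.map φ).mulVecLin).comap (LinearMap.toSpanSingleton R _ w)
  have hI : ∀ a, a ∈ I ↔ a • w ∈ LinearMap.range (D.map φ).mulVecLin := fun a => Iff.rfl
  have hI1 : I ≠ ⊤ := by
    rw [Ne, Ideal.eq_top_iff_one, hI, one_smul]
    exact hmem
  obtain ⟨Q, hQ⟩ := I.nonempty_minimalPrimes hI1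
  have hQp := hQ.1.1
  let S := Localization.AtPrime Q
  -- As `φ` is a power map, it preserves primes under preimage and so extends to the localization,
  -- again as the `q`-th power.
  have hcomap : Q = Q.comap φ := by
    ext a
    rw [Ideal.mem_comap, hφ, hQp.pow_mem_iff_mem q hq]
  let ψ : S →+* S := Localization.localRingHom Q Q φ hcomap
  have hψ : ∀ a, ψ a = a ^ q := by
    intro a
    obtain ⟨a, s, rfl⟩ := IsLocalization.exists_mk'_eq Q.primeCompl a
    rw [Localization.localRingHom_mk', ← IsLocalization.mk'_pow]
    congr 1
    · exact hφ a
    · exact Subtype.ext (hφ s)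
  have hψι : ψ ∘ algebraMap R S = algebraMap R S ∘ φ :=
    funext fun a => Localization.localRingHom_to_map _ _ _ _ a
  have hmapmap : ∀ {r c : ℕ} (E : Matrix (Fin r) (Fin c) R),
      (E.map (algebraMap R S)).map ψ = (E.map φ).map (algebraMap R S) := fun E => by
    rw [Matrix.map_map, Matrix.map_map, hψι]
  have hexS := exact_map_of_isLocalization Q.primeCompl S h
  have hmemS : algebraMap R S ∘ w ∈ Submodule.span S
      ((fun z => ψ ∘ z) '' {z | C.map (algebraMap R S) *ᵥ z = 0}) := by
    refine (hC.map_of_isLocalization Q.primeCompl S).mem_span_of_torsion ψ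
      (fun m hm _ _ C hC => ih m (by omega) ψ hψ hq C hC) ?_ ?_
    · rw [hmapmap, map_mulVec_comp, hw]
      ext i
      simp
    · intro a ha
      rw [span_image_ker_eq_range ψ hexS, hmapmap]
      obtain ⟨a, s, rfl⟩ := IsLocalization.exists_mk'_eq Q.primeCompl a
      rw [IsLocalization.AtPrime.mk'_mem_maximal_iff S Q] at ha
      obtain ⟨u, hu, n, hun⟩ := Ideal.exists_mul_pow_mem_of_mem_minimalPrimes hQ ha
      obtain ⟨y, hy⟩ := (hI _).mp hun
      refine ⟨n, ?_⟩
      obtain ⟨v, hv⟩ := (IsLocalization.map_units S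
        (⟨u, hu⟩ * s ^ n : Q.primeCompl)).exists_left_inv
      have : IsLocalization.mk' S a s ^ n = v * algebraMap R S (u * a ^ n) := by
        have h1 : IsLocalization.mk' S a s * algebraMap R S s = algebraMap R S a :=
          IsLocalization.mk'_spec S a s
        rw [map_mul, map_pow, ← h1, mul_pow]
        rw [Submonoid.coe_mul, map_mul, SubmonoidClass.coe_pow, map_pow] at hv
        linear_combination (- IsLocalization.mk' S a s ^ n) * hv
      rw [this, ← smul_smul, ← algebraMap_comp_smul, ← hy, Matrix.mulVecLin_apply,
        ← map_mulVec_comp]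
      exact Submodule.smul_mem _ _ ⟨_, rfl⟩
  rw [span_image_ker_eq_range ψ hexS, hmapmap] at hmemS
  obtain ⟨t, ht, htw⟩ := exists_smul_mem_range_of_algebraMap_comp Q.primeCompl S hmemS
  -- Membership at `Q` gives `t ∉ Q` annihilating the class of `w`, although `I ≤ Q`.
  exact ht (hQ.1.2 ((hI t).mpr htw))

end Matrix

/-! ### Coherent regular rings and flatness of Frobenius. -/

section Coherent

variable {A : Type u} [CommRing A]

/-- The first coordinate has a finitely generated ideal as image, so its kernel is finitely
generated; the remaining coordinates are pulled back to a free cover of that kernel. -/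
lemma IsCoherentRing.fg_ker (hA : IsCoherentRing A) {r c : ℕ}
    (f : (Fin c → A) →ₗ[A] (Fin r → A)) : (LinearMap.ker f).FG := by
  induction r generalizing c with
  | zero =>
    have : LinearMap.ker f = ⊤ :=
      LinearMap.ker_eq_top.mpr (LinearMap.ext fun _ => Subsingleton.elim _ _)
    rw [this]
    exact Module.Finite.fg_top
  | succ r ih =>
    let f₀ : (Fin c → A) →ₗ[A] A := LinearMap.proj 0 ∘ₗ f
    have : Module.FinitePresentation A (LinearMap.range f₀) := hA (LinearMap.range f₀)
      (LinearMap.range_eq_map f₀ ▸ Module.Finite.fg_top.map f₀)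
    have h₀ : (LinearMap.ker f₀).FG := by
      rw [← LinearMap.ker_rangeRestrict]
      exact Module.FinitePresentation.fg_ker _ f₀.surjective_rangeRestrict
    obtain ⟨d, D, hD⟩ := (Submodule.fg_iff_exists_fin_linearMap _ _).mp h₀
    let f₁ : (Fin c → A) →ₗ[A] (Fin r → A) := LinearMap.funLeft A A Fin.succ ∘ₗ f
    have hker : LinearMap.ker f = (LinearMap.ker (f₁ ∘ₗ D)).map D := by
      ext x
      simp only [LinearMap.mem_ker, Submodule.mem_map, LinearMap.comp_apply]
      constructor
      · intro hx
        have hx₀ : x ∈ LinearMap.range D := by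
          rw [hD, LinearMap.mem_ker]
          exact congrFun hx 0
        obtain ⟨y, rfl⟩ := hx₀
        exact ⟨y, funext fun i => congrFun hx i.succ, rfl⟩
      · rintro ⟨y, hy, rfl⟩
        have hy₀ : D y ∈ LinearMap.ker f₀ := hD ▸ LinearMap.mem_range_self D y
        exact funext fun i => Fin.cases hy₀ (fun i => congrFun hy i) i
    rw [hker]
    exact (ih _).map D

lemma IsCoherentRing.exists_exact (hA : IsCoherentRing A) {r c : ℕ}
    (C : Matrix (Fin r) (Fin c) A) :
    ∃ (d : ℕ) (D : Matrix (Fin c) (Fin d) A), Function.Exact D.mulVec C.mulVec := by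
  obtain ⟨d, D, hD⟩ := (Submodule.fg_iff_exists_fin_linearMap _ _).mp (hA.fg_ker C.mulVecLin)
  refine ⟨d, LinearMap.toMatrix' D, fun y => ?_⟩
  have hDy : ∀ x, (LinearMap.toMatrix' D).mulVec x = D x := fun x => LinearMap.toMatrix'_mulVec D x
  have : (LinearMap.toMatrix' D).mulVec = D := funext hDy
  rw [this, ← LinearMap.coe_range, hD]
  rfl

/-- Coherence provides the next finite free module, and dimension shifting lowers `n`. For `n = 0`
the image of `C` is a summand, and a projection onto it lifts through `C` to a pseudoinverse. -/
lemma IsCoherentRing.cokerPdLE (hA : IsCoherentRing A) {n r c : ℕ} {C : Matrix (Fin r) (Fin c) A}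
    (h : HasProjectiveDimensionLE (ModuleCat.of A C.Coker) n) : C.CokerPdLE n := by
  induction n generalizing r c with
  | zero =>
    rw [← projective_iff_hasProjectiveDimensionLE_zero, ← IsProjective.iff_projective] at h
    let K := LinearMap.range C.mulVecLin
    obtain ⟨σ, hσ⟩ := Module.projective_lifting_property K.mkQ LinearMap.id K.mkQ_surjective
    have hmem : ∀ x, ((LinearMap.id : (Fin r → A) →ₗ[A] (Fin r → A)) - σ ∘ₗ K.mkQ) x ∈ K :=
        fun x => by
      rw [← Submodule.Quotient.mk_eq_zero, ← Submodule.mkQ_apply]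
      have := LinearMap.congr_fun hσ (K.mkQ x)
      simp only [LinearMap.comp_apply, LinearMap.id_apply] at this
      rw [LinearMap.sub_apply, map_sub, LinearMap.comp_apply, this, LinearMap.id_apply, sub_self]
    obtain ⟨g, hg⟩ := Module.projective_lifting_property C.mulVecLin.rangeRestrict
      ((LinearMap.id - σ ∘ₗ K.mkQ).codRestrict K hmem) C.mulVecLin.surjective_rangeRestrict
    refine ⟨LinearMap.toMatrix' g, Matrix.toLin'.injective (LinearMap.ext fun x => ?_)⟩
    have h1 := congrArg Subtype.val (LinearMap.congr_fun hg (C.mulVec x))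
    have h2 : K.mkQ (C.mulVec x) = 0 := (Submodule.Quotient.mk_eq_zero _).mpr ⟨x, rfl⟩
    simp only [LinearMap.codRestrict_apply, LinearMap.sub_apply, LinearMap.comp_apply,
      LinearMap.id_apply, h2, map_zero, sub_zero] at h1
    rw [Matrix.mul_assoc]
    simp only [Matrix.toLin'_mul, LinearMap.comp_apply, Matrix.toLin'_toMatrix']
    exact h1
  | succ n ih =>
    obtain ⟨d, D, hD⟩ := hA.exists_exact C
    refine ⟨d, D, hD, ih ?_⟩
    exact ((shortExact_moduleCat _ _ (Matrix.cokerDesc_injective hD) (Matrix.cokerDesc_exact hD)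
      (Submodule.mkQ_surjective _)).hasProjectiveDimensionLT_X₃_iff n
        (ModuleCat.projective_of_categoryTheory_projective _)).mp h

/-- Over a coherent regular ring, the cokernel of a row matrix has finite projective dimension. -/
lemma exists_cokerPdLE_of_regular (hA : IsCoherentRing A) (hreg : IsNonNoetherianRegularRing A)
    {c : ℕ} (C : Matrix (Fin 1) (Fin c) A) : ∃ n, C.CokerPdLE n := by
  let I : Ideal A := Ideal.span (Set.range (C 0))
  obtain ⟨n, hn⟩ := hreg I (Submodule.fg_span (Set.finite_range (C 0)))
  refine ⟨n + 1, hA.cokerPdLE ?_⟩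
  let f : I →ₗ[A] (Fin 1 → A) := LinearMap.pi fun _ => I.subtype
  have hf : Function.Injective f := fun x y hxy => Subtype.ext (congrFun hxy 0)
  have hfg : Function.Exact f (LinearMap.range C.mulVecLin).mkQ := by
    intro x
    rw [Submodule.mkQ_apply, Submodule.Quotient.mk_eq_zero]
    have hI : ∀ a, a ∈ I ↔ ∃ y : Fin c → A, ∑ j, C 0 j * y j = a := fun a => by
      simp only [I, Ideal.mem_span_range_iff_exists_fun, mul_comm]
    constructor
    · rintro ⟨y, rfl⟩
      refine ⟨⟨_, (hI _).mpr ⟨y, rfl⟩⟩, funext fun i => ?_⟩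
      fin_cases i
      rfl
    · rintro ⟨⟨a, ha⟩, rfl⟩
      obtain ⟨y, hy⟩ := (hI a).mp ha
      refine ⟨y, funext fun i => ?_⟩
      fin_cases i
      exact hy
  have hS := shortExact_moduleCat f _ hf hfg (Submodule.mkQ_surjective _)
  exact (hS.hasProjectiveDimensionLT_X₃_iff n
    (ModuleCat.projective_of_categoryTheory_projective _)).mpr hn

/-- Over a coherent regular ring, the syzygies of the `q`-th powers of a finite family are generated
by the `q`-th powers of the syzygies, if `q`-th powers are additive. -/
lemma exists_syzygies_pow (hA : IsCoherentRing A) (hreg : IsNonNoetherianRegularRing A)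
    {c : ℕ} (a : Fin c → A) : ∃ (d : ℕ) (D : Matrix (Fin c) (Fin d) A),
      (∀ j, ∑ i, a i * D i j = 0) ∧ ∀ (φ : A →+* A) (q : ℕ), 0 < q → (∀ x, φ x = x ^ q) →
        ∀ w : Fin c → A, ∑ i, φ (a i) * w i = 0 → ∃ y : Fin d → A, ∀ i,
          w i = ∑ j, φ (D i j) * y j := by
  let C : Matrix (Fin 1) (Fin c) A := Matrix.of fun _ => a
  obtain ⟨n, hn⟩ := exists_cokerPdLE_of_regular hA hreg C
  obtain ⟨d, D, hD⟩ := hA.exists_exact C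
  refine ⟨d, D, fun j => congrFun (congrFun (Matrix.mul_eq_zero_of_exact hD) 0) j,
    fun φ q hq hφ w hw => ?_⟩
  have hex := (Matrix.CokerPdLE.kerSpannedBy n φ hφ hq C hn).exact hD
  obtain ⟨y, hy⟩ := (hex w).mp (funext fun _ => hw)
  exact ⟨y, fun i => (congrFun hy i).symm⟩

theorem frobenius_flat_of_regular (p : ℕ) [Fact p.Prime] [CharP A p] (hA : IsCoherentRing A)
    (hreg : IsNonNoetherianRegularRing A) : (frobenius A p).Flat := by
  -- The module structure is explicit: `A` acts on itself through Frobenius.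
  refine @Module.Flat.of_forall_isTrivialRelation A A _ _ (frobenius A p).toAlgebra.toModule ?_
  intro l f x hx
  obtain ⟨d, D, hD, h⟩ := exists_syzygies_pow hA hreg f
  obtain ⟨y, hy⟩ := h (frobenius A p) p (Fact.out : p.Prime).pos (fun _ => rfl) x hx
  exact ⟨d, D, y, hy, hD⟩

end Coherent

/-! ### Value maps and tight closure. -/

section Value

variable {A : Type u} [CommRing A] {v : A → WithTop ℝ}

lemma IsValueMap.le_sum (hv : IsValueMap v) {t : WithTop ℝ} {ι : Type*} (s : Finset ι) (f : ι → A)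
    (h : ∀ i ∈ s, t ≤ v (f i)) : t ≤ v (∑ i ∈ s, f i) := by
  classical
  induction s using Finset.induction_on with
  | empty => simp [(hv.eq_top_iff 0).mpr rfl]
  | insert i s hi ih =>
    rw [Finset.sum_insert hi]
    exact (le_min (h i (by simp)) (ih fun j hj => h j (by simp [hj]))).trans (hv.map_add _ _)

lemma IsNormalizedValueMap.le_pow (hv : IsNormalizedValueMap v) {a : A} {ε : ℝ}
    (ha : (ε : WithTop ℝ) ≤ v a) (n : ℕ) : ((n * ε : ℝ) : WithTop ℝ) ≤ v (a ^ n) := by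
  induction n with
  | zero => simpa only [Nat.cast_zero, zero_mul, WithTop.coe_zero] using hv.nonneg (a ^ 0)
  | succ n ih =>
    rw [pow_succ, hv.map_mul]
    refine le_trans (le_of_eq ?_) (add_le_add ih ha)
    rw [← WithTop.coe_add, Nat.cast_succ, add_one_mul]

lemma exists_pos_forall_le {n : ℕ} (f : Fin n → WithTop ℝ) (hf : ∀ i, 0 < f i) :
    ∃ ε : ℝ, 0 < ε ∧ ∀ i, (ε : WithTop ℝ) ≤ f i := by
  induction n with
  | zero => exact ⟨1, one_pos, fun i => i.elim0⟩
  | succ n ih =>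
    obtain ⟨ε, hε, h⟩ := ih (fun i => f i.succ) fun i => hf _
    obtain ⟨δ, hδ, h0⟩ : ∃ δ : ℝ, 0 < δ ∧ (δ : WithTop ℝ) ≤ f 0 := by
      have h0 := hf 0
      generalize f 0 = x at h0
      induction x using WithTop.recTopCoe with
      | top => exact ⟨1, one_pos, le_top⟩
      | coe x => exact ⟨x, by exact_mod_cast h0, le_rfl⟩
    refine ⟨min ε δ, lt_min hε hδ, fun i => Fin.cases ?_ (fun i => ?_) i⟩
    · exact le_trans (WithTop.coe_le_coe.mpr (min_le_right _ _)) h0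
    · exact le_trans (WithTop.coe_le_coe.mpr (min_le_left _ _)) (h i)

lemma bracketPower_span_range (φ : A →+* A) {q : ℕ} (hφ : ∀ x, φ x = x ^ q)
    {n : ℕ} (a : Fin n → A) :
    bracketPower (Ideal.span (Set.range a)) q ≤ Ideal.span (Set.range fun i => φ (a i)) := by
  rw [bracketPower, Ideal.span_le]
  rintro _ ⟨x, hx, rfl⟩
  obtain ⟨b, rfl⟩ := Ideal.mem_span_range_iff_exists_fun.mp hx
  rw [← hφ, map_sum]
  refine Ideal.sum_mem _ fun i _ => ?_
  rw [map_mul]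
  exact Ideal.mul_mem_left _ _ (Ideal.subset_span ⟨i, rfl⟩)

lemma ne_zero_of_mem_minimalPrimesCompl [Nontrivial A] {c : A} (hc : c ∈ minimalPrimesCompl A) :
    c ≠ 0 := by
  rintro rfl
  obtain ⟨P, hP⟩ := (⊥ : Ideal A).nonempty_minimalPrimes bot_ne_top
  exact hc P hP P.zero_mem

theorem isTightlyClosed_of_regular (p : ℕ) [Fact p.Prime] [CharP A p] (hA : IsCoherentRing A)
    (hreg : IsNonNoetherianRegularRing A) (hv : IsNormalizedValueMap v) {I : Ideal A}
    (hI : I.FG) : IsTightlyClosed p I := by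
  have hp : p.Prime := Fact.out
  have : Nontrivial A := CharP.nontrivial_of_char_ne_one hp.ne_one
  apply Set.Subset.antisymm
  swap
  · refine fun x hx => ⟨1, fun P hP h1 => hP.1.1.ne_top (P.eq_top_of_isUnit_mem h1 isUnit_one), 0,
      fun e _ => ?_⟩
    rw [one_mul]
    exact Ideal.subset_span ⟨x, hx, rfl⟩
  rintro x ⟨c, hc, N, hN⟩
  by_contra hx
  obtain ⟨n, a, rfl⟩ := Submodule.fg_iff_exists_fin_generating_family.mp hI
  change ¬ x ∈ Ideal.span (Set.range a) at hx
  -- `D` is chosen before `q`, so one `ε` serves all powers.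
  obtain ⟨d, D, hD, h⟩ := exists_syzygies_pow hA hreg (Fin.cons x a)
  -- A unit coefficient of `x` in a syzygy would put `x` in the ideal.
  have hnu : ∀ j, ¬ IsUnit (D 0 j) := by
    intro j hj
    have hj' := hD j
    rw [Fin.sum_univ_succ, Fin.cons_zero, add_eq_zero_iff_eq_neg] at hj'
    refine hx ((Ideal.mul_unit_mem_iff_mem _ hj).mp ?_)
    rw [hj']
    refine neg_mem (Ideal.sum_mem _ fun i _ => Ideal.mul_mem_right _ _ ?_)
    exact Ideal.subset_span ⟨i, rfl⟩
  obtain ⟨ε, hε, hεD⟩ := exists_pos_forall_le (fun j => v (D 0 j))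
    fun j => hv.pos_of_not_isUnit _ (hnu j)
  have hle : ∀ e, N ≤ e → (((p ^ e : ℕ) * ε : ℝ) : WithTop ℝ) ≤ v c := by
    intro e he
    obtain ⟨b, hb⟩ := Ideal.mem_span_range_iff_exists_fun.mp
      (bracketPower_span_range (iterateFrobenius A p e) (fun _ => rfl) a (hN e he))
    -- The relation `c x^q = ∑ bᵢ aᵢ^q` is a syzygy of the `q`-th powers with first entry `c`.
    obtain ⟨y, hy⟩ := h (iterateFrobenius A p e) (p ^ e) (pow_pos hp.pos e) (fun _ => rfl)
      (Fin.cons c fun i => - b i) (by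
        rw [Fin.sum_univ_succ]
        simp only [Fin.cons_zero, Fin.cons_succ, mul_neg, Finset.sum_neg_distrib]
        rw [add_neg_eq_zero, iterateFrobenius_def, mul_comm, ← hb]
        exact Finset.sum_congr rfl fun i _ => mul_comm _ _)
    have hc0 := hy 0
    rw [Fin.cons_zero] at hc0
    rw [hc0]
    refine hv.le_sum _ _ fun j _ => ?_
    rw [hv.map_mul, iterateFrobenius_def]
    exact (hv.le_pow (hεD j) _).trans (le_add_of_nonneg_right (hv.nonneg _))
  have hc0 : v c ≠ ⊤ := fun h0 => ne_zero_of_mem_minimalPrimesCompl hc ((hv.eq_top_iff c).mp h0)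
  obtain ⟨r, hr⟩ := WithTop.ne_top_iff_exists.mp hc0
  obtain ⟨m, hm⟩ := exists_nat_gt (r / ε)
  have h1 := hle (N + m) (Nat.le_add_right _ _)
  rw [← hr, WithTop.coe_le_coe] at h1
  rw [div_lt_iff₀ hε] at hm
  have h2 : (m : ℝ) ≤ (p ^ (N + m) : ℕ) := by
    exact_mod_cast (Nat.le_add_left m N).trans (Nat.lt_pow_self hp.one_lt).le
  nlinarith [mul_le_mul_of_nonneg_right h2 hε.le]

end Value

theorem lemma2p1 {A : Type*} [CommRing A] (p : ℕ) [Fact p.Prime] [CharP A p]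
    (hcoh : IsCoherentRing A) (hreg : IsNonNoetherianRegularRing A) :
    (frobenius A p).Flat ∧
    ((∃ v : A → WithTop ℝ, IsNormalizedValueMap v) →
      ∀ I : Ideal A, I.FG → IsTightlyClosed p I) :=
  ⟨frobenius_flat_of_regular p hcoh hreg,
    fun ⟨_, hv⟩ _ hI => isTightlyClosed_of_regular p hcoh hreg hv hI⟩
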